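/- Let $n,d\ge 1$ be integers and $\delta\in(0,1)$. A problem is a family $\nu=(\nu_{ij})_{1\le i\le n,\,1\le j\le d}$ of probability distributions on $\mathbb R$; $\nu_{ij}$, with mean $M_{ij}$, is the law of the performance of expert $i$ on task $j$. We consider problems such that every $\nu_{ij}$ is $1$-sub-Gaussian, i.e. $\mathbb E_{X\sim\nu_{ij}}[e^{t(X-M_{ij})}]\le e^{t^2/2}$ for all $t\in\mathbb R$; $M_{ij}\in[0,1]$ for all $i,j$; and there is a permutation $\pi$ of $\{1,\dots,n\}$ with $M_{\pi(i)j}\ge M_{\pi(i+1)j}$ for all $i\le n-1$ and all $j$, and with $M_{\pi(i)}\ne M_{\pi(1)}$ (as rows of $M$) for all $i\ge 2$. Call such problems admissible; $\pi(1)$ is the unique best expert. An algorithm (possibly randomized) sequentially chooses, on the basis of its past observations and its internal randomness, a pair (expert $i$, task $j$), and receives an independent sample from $\nu_{ij}$; on the same basis it decides when to stop, and it then returns an expert $\hat k$. Write $N\in\{0,1,2,\dots\}\cup\{\infty\}$ for its total number of queries. It is $\delta$-accurate for best-expert identification if, for every admissible problem, $\mathbb P(\hat k\ne\pi(1))\le\delta$,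 where never stopping counts as an error. Let $0<\overline\Delta_1\le\dots\le\overline\Delta_{n-1}$ with $\overline\Delta_i^2\le d$ for all $i$, and let $\overline{\mathbb D}^{n,d}_{\overline{\boldsymbol\Delta}}$ be the class of admissible problems such that $\|M_{\pi(1)}-M_{\pi(i+1)}\|_2^2\ge\overline\Delta_i^2$ for $i=1,\dots,n-1$. Then for every algorithm $A$ that is $\delta$-accurate for best-expert identification, $$\max_{\mathcal B\in\overline{\mathbb D}^{n,d}_{\overline{\boldsymbol\Delta}}}\mathbb E_{\mathcal B,A}[N]\ \ge\ \sum_{i=1}^{n-1}\frac{d}{\overline\Delta_i^2}\,\log\frac1{4\delta},$$ in the sense that some problem $\mathcal B$ of the class satisfies $\mathbb E_{\mathcal B,A}[N]\ge\sum_{i=1}^{n-1}\frac{d}{\overline\Delta_i^2}\log\frac1{4\delta}$. -/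

import Mathlib

open MeasureTheory ProbabilityTheory

open scoped ENNReal

noncomputable section

namespace ActiveRanking

/-! ### Problems -/

/-- A performance distribution: `ν i j` is the law of the performance of expert `i` on task `j`. -/
abbrev Problem (n d : ℕ) : Type := Fin n → Fin d → ProbabilityMeasure ℝ

/-- The matrix of mean performances. -/
def Problem.mean {n d : ℕ} (ν : Problem n d) : Matrix (Fin n) (Fin d) ℝ :=
  fun i j => ∫ x, x ∂(ν i j : Measure ℝ)

/-- Every `ν i j` is `1`-sub-Gaussian: `E[exp (t (X - E X))] ≤ exp (t ^ 2 / 2)` for all real `t`. -/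
def Problem.IsSubGaussian {n d : ℕ} (ν : Problem n d) : Prop :=
  ∀ i j, HasSubgaussianMGF (fun x : ℝ => x - ν.mean i j) 1 (ν i j : Measure ℝ)

/-- `M` is an admissible mean matrix for best-expert identification with `n = m + 1` experts, and
`π` orders its rows from the best (`π 0`) to the worst (`π (Fin.last m)`). -/
structure IsAdmissible {m d : ℕ} (M : Matrix (Fin (m + 1)) (Fin d) ℝ)
    (π : Equiv.Perm (Fin (m + 1))) : Prop where
  /-- Monotonicity: each expert in the order is at least as good as the next one in all tasks. -/
  monotone : ∀ (i : Fin m) (j : Fin d), M (π i.succ) j ≤ M (π i.castSucc) j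
  /-- Mean performances lie in `[0, 1]`. -/
  bounded : ∀ i j, M i j ∈ Set.Icc (0 : ℝ) 1
  /-- Identifiability: no other expert has the same row as the best one. -/
  identifiable : ∀ i : Fin m, ∃ j, M (π i.succ) j ≠ M (π 0) j

/-- The squared Euclidean distance between two rows of a matrix. -/
def rowSqDist {n d : ℕ} (M : Matrix (Fin n) (Fin d) ℝ) (i k : Fin n) : ℝ :=
  ∑ j, (M i j - M k j) ^ 2

/-- The class of `1`-sub-Gaussian problems with an admissible mean matrix for which the squared
distance from the best expert to the next ones in the order is at least `Δ 0 ^ 2`, `Δ 1 ^ 2`, …. -/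
def gapClass {m : ℕ} (d : ℕ) (Δ : Fin m → ℝ) : Set (Problem (m + 1) d) :=
  {ν | ν.IsSubGaussian ∧ ∃ π : Equiv.Perm (Fin (m + 1)), IsAdmissible ν.mean π ∧
    ∀ i : Fin m, Δ i ^ 2 ≤ rowSqDist ν.mean (π 0) (π i.succ)}

/-! ### Algorithms -/

/-- The observations after `t` queries: the queried pairs (expert, task) and the samples. -/
abbrev History (n d t : ℕ) : Type := Fin t → (Fin n × Fin d) × ℝ

/-- A sequential, possibly randomized algorithm for best-expert identification. Its internal
randomness is a seed with law `seedLaw` on an arbitrary probability space `S`. After `t` queries it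
halts if the seed and the past observations lie in `stopSet t`; it then returns `answer t`, and
otherwise it makes the query `query t`. -/
structure Algorithm (n d : ℕ) (S : Type*) [MeasurableSpace S] where
  seedLaw : ProbabilityMeasure S
  stopSet : ∀ t : ℕ, Set (S × History n d t)
  answer : ∀ t : ℕ, S × History n d t → Fin n
  query : ∀ t : ℕ, S × History n d t → Fin n × Fin d
  measurableSet_stopSet : ∀ t, MeasurableSet (stopSet t)
  measurable_answer : ∀ t, Measurable (answer t)
  measurable_query : ∀ t, Measurable (query t)

/-- The sample space: a seed, and for each round a fresh table of samples, of which only the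
entry queried in that round is revealed. -/
abbrev Outcome (n d : ℕ) (S : Type*) : Type _ := S × (ℕ → Fin n × Fin d → ℝ)

namespace Algorithm

variable {n d : ℕ} {S : Type*} [MeasurableSpace S]

/-- The probability when `A` is run on the problem `ν`: the seed has law `seedLaw`, the samples
are independent of it and of each other, and samples at the pair `(i, j)` have law `ν i j`. -/
def prob (A : Algorithm n d S) (ν : Problem n d) : Measure (Outcome n d S) :=
  (A.seedLaw : Measure S).prod
    (Measure.infinitePi fun _ : ℕ => Measure.pi fun p : Fin n × Fin d => (ν p.1 p.2 : Measure ℝ))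

/-- The observations after `t` queries. (The recursion ignores stopping; only the values up to the
stopping time matter.) -/
def history (A : Algorithm n d S) (ω : Outcome n d S) : (t : ℕ) → History n d t
  | 0 => Fin.elim0
  | t + 1 =>
    Fin.snoc (α := fun _ => (Fin n × Fin d) × ℝ) (A.history ω t)
      (A.query t (ω.1, A.history ω t), ω.2 t (A.query t (ω.1, A.history ω t)))

/-- The total number of queries: the first time at which `A` decides to stop, `⊤` if there
is none. -/
def numQueries (A : Algorithm n d S) (ω : Outcome n d S) : ℕ∞ :=
  ⨅ (t : ℕ) (_ : (ω.1, A.history ω t) ∈ A.stopSet t), (t : ℕ∞)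

open Classical in
/-- The expert that `A` returns; `none` if `A` never stops. -/
def output (A : Algorithm n d S) (ω : Outcome n d S) : Option (Fin n) :=
  if A.numQueries ω = ⊤ then none
  else some (A.answer (A.numQueries ω).toNat (ω.1, A.history ω (A.numQueries ω).toNat))

/-- The expected number of queries (possibly infinite) when `A` is run on `ν`. -/
def expectedQueries (A : Algorithm n d S) (ν : Problem n d) : ℝ≥0∞ :=
  ∫⁻ ω, (A.numQueries ω : ℝ≥0∞) ∂(A.prob ν)

/-- `A` is `δ`-accurate for best-expert identification: on every `1`-sub-Gaussian problem with an
admissible mean matrix, it fails to return the best expert with probability at most `δ`. -/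
def IsAccurate {m : ℕ} (A : Algorithm (m + 1) d S) (δ : ℝ) : Prop :=
  ∀ (ν : Problem (m + 1) d) (π : Equiv.Perm (Fin (m + 1))), ν.IsSubGaussian →
    IsAdmissible ν.mean π → A.prob ν {ω | A.output ω ≠ some (π 0)} ≤ ENNReal.ofReal δ

end Algorithm

end ActiveRanking

end

/-! The bound is proved on one explicit problem: unit-variance Gaussians, expert `0` with mean `1`
on every task, expert `k + 1` with mean `1 - g k` on every task, where `g k = Δ k / √d`. The squared
distance between rows `0` and `k + 1` is then exactly `Δ k ^ 2`. Since the gap is spread evenly, no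
task is more informative than another.

For each `i`, compare it with the alternative in which expert `i + 1` is raised to `1` and expert
`0` is lowered to `1 - ε`. The best expert changes, so an accurate algorithm must tell the two
problems apart. Means are capped at `1`, so expert `i + 1` can become the unique best only if row
`0` moves, but `ε` may be arbitrarily small. A query of expert `i + 1` carries information `g i ^ 2
/ 2`, a query of expert `0` only `ε ^ 2 / 2`, and any other query none. The information inequality
`log_le_sum_sq` says that the expected total is at least `log (1 / (4 * δ))`. With `ε` small, this
forces `log (1 / (4 * δ)) / g i ^ 2` expected queries of expert `i + 1`, and these bounds add up
over `i`.

The information inequality combines Wald's identity (`integral_totalLoss`), which expresses the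
expected log-likelihood ratio at the stopping time through expected visits, with a change of measure
at that time (`setLIntegral_exp_neg_totalLoss`). Jensen and Cauchy–Schwarz then bound the Hellinger
affinity `E[√Z]` of the two stopped laws from both sides. Both ingredients rest on
`map_state_table`: the table of a round is independent of everything that determines the query made
in it. -/

noncomputable section

namespace ActiveRanking

namespace Algorithm

variable {n d : ℕ} {S : Type*} [MeasurableSpace S]

/-! ### The observed process -/

/-- The seed together with the observations after `t` queries. -/
def state (A : Algorithm n d S) (t : ℕ) (ω : Outcome n d S) : S × History n d t :=
  (ω.1, A.history ω t)

/-- The pair queried in round `t`. -/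
def queryAt (A : Algorithm n d S) (t : ℕ) (ω : Outcome n d S) : Fin n × Fin d :=
  A.query t (A.state t ω)

/-- The law of the table of samples of one round. -/
def tableLaw (ν : Problem n d) : Measure (Fin n × Fin d → ℝ) :=
  Measure.pi fun p => (ν p.1 p.2 : Measure ℝ)

instance (ν : Problem n d) : IsProbabilityMeasure (tableLaw ν) := by
  unfold tableLaw; infer_instance

instance (A : Algorithm n d S) (ν : Problem n d) : IsProbabilityMeasure (A.prob ν) := by
  unfold prob; infer_instance

lemma history_succ (A : Algorithm n d S) (t : ℕ) (ω : Outcome n d S) :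
    A.history ω (t + 1) = Fin.snoc (α := fun _ => (Fin n × Fin d) × ℝ) (A.history ω t)
      (A.queryAt t ω, ω.2 t (A.queryAt t ω)) := rfl

lemma history_apply (A : Algorithm n d S) (ω : Outcome n d S) {t : ℕ} (i : Fin t) :
    A.history ω t i = (A.queryAt i ω, ω.2 i (A.queryAt i ω)) := by
  induction t with
  | zero => exact i.elim0
  | succ t ih =>
    rw [history_succ]
    refine Fin.lastCases ?_ (fun i => ?_) i
    · simp
    · simp [ih i]

lemma measurable_eval_uncurry : Measurable
    fun x : (Fin n × Fin d → ℝ) × (Fin n × Fin d) => x.1 x.2 := by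
  refine measurable_from_prod_countable_left fun q => ?_
  exact measurable_pi_apply q

lemma measurable_snoc {t : ℕ} : Measurable
    fun x : History n d t × ((Fin n × Fin d) × ℝ) =>
      (Fin.snoc (α := fun _ => (Fin n × Fin d) × ℝ) x.1 x.2 : History n d (t + 1)) := by
  refine measurable_pi_lambda _ fun i => ?_
  refine Fin.lastCases ?_ (fun i => ?_) i
  · simpa using measurable_snd
  · simp only [Fin.snoc_castSucc]
    exact (measurable_pi_apply i).comp measurable_fst

lemma measurable_state (A : Algorithm n d S) (t : ℕ) : Measurable (A.state t) := by
  refine measurable_fst.prodMk ?_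
  induction t with
  | zero => exact measurable_const
  | succ t ih =>
    simp only [history_succ]
    have hq : Measurable (A.queryAt t) := (A.measurable_query t).comp (measurable_fst.prodMk ih)
    have ht : Measurable fun ω : Outcome n d S => ω.2 t :=
      (measurable_pi_apply t).comp measurable_snd
    exact measurable_snoc.comp (ih.prodMk (hq.prodMk (measurable_eval_uncurry.comp (ht.prodMk hq))))

lemma measurable_queryAt (A : Algorithm n d S) (t : ℕ) : Measurable (A.queryAt t) :=
  (A.measurable_query t).comp (A.measurable_state t)

/-- The observations after `t` queries depend on the first `t` tables only. -/
lemma state_congr (A : Algorithm n d S) (t : ℕ) {ω ω' : Outcome n d S} (h : ω.1 = ω'.1)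
    (h' : ∀ s < t, ω.2 s = ω'.2 s) : A.state t ω = A.state t ω' := by
  induction t with
  | zero => exact Prod.ext h rfl
  | succ t ih =>
    have h1 := ih fun s hs => h' s (hs.trans t.lt_succ_self)
    have hq : A.queryAt t ω = A.queryAt t ω' := by rw [queryAt, h1, queryAt]
    have h2 : A.history ω t = A.history ω' t := congrArg Prod.snd h1
    refine Prod.ext h ?_
    change A.history ω (t + 1) = A.history ω' (t + 1)
    rw [history_succ, history_succ, h2, hq, h' t t.lt_succ_self]

/-- In each round, the fresh table is independent of the seed and the past observations. -/
lemma map_state_table (A : Algorithm n d S) (ν : Problem n d) (t : ℕ) :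
    (A.prob ν).map (fun ω => (A.state t ω, ω.2 t)) =
      ((A.prob ν).map (A.state t)).prod (tableLaw ν) := by
  set R : Measure (ℕ → Fin n × Fin d → ℝ) := Measure.infinitePi fun _ => tableLaw ν with hR
  have hP : A.prob ν = (A.seedLaw : Measure S).prod R := rfl
  have hind : iIndepFun (fun (s : ℕ) (y : ℕ → Fin n × Fin d → ℝ) => y s) R :=
    iIndepFun_infinitePi (P := fun _ : ℕ => tableLaw ν) (X := fun _ y => y)
      (fun _ => measurable_id)
  let past : (ℕ → Fin n × Fin d → ℝ) → (Finset.range t → Fin n × Fin d → ℝ) := fun y i => y i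
  have hpast : Measurable past := by fun_prop
  have hev : Measurable fun y : ℕ → Fin n × Fin d → ℝ => y t := measurable_pi_apply t
  have hpair : R.map (fun y => (past y, y t)) = (R.map past).prod (tableLaw ν) := by
    have h0 := hind.indepFun_finset (Finset.range t) {t} (by simp) (fun i => measurable_pi_apply i)
    have h1 : IndepFun past (fun y => y t) R :=
      h0.comp (φ := id) (ψ := fun (z : ({t} : Finset ℕ) → Fin n × Fin d → ℝ) => z ⟨t, by simp⟩)
        measurable_id (measurable_pi_apply _)
    rw [(indepFun_iff_map_prod_eq_prod_map_map hpast.aemeasurable hev.aemeasurable).1 h1]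
    congr 1
    exact Measure.infinitePi_map_eval (fun _ : ℕ => tableLaw ν) t
  -- Padding the first `t` tables by zeros exhibits the state as a function `G` of the seed and
  -- these tables alone; by `state_congr` the padding has no effect.
  let ext : (Finset.range t → Fin n × Fin d → ℝ) → (ℕ → Fin n × Fin d → ℝ) :=
    fun z s => if h : s ∈ Finset.range t then z ⟨s, h⟩ else 0
  have hext : Measurable ext := by
    refine measurable_pi_lambda _ fun s => ?_
    by_cases h : s ∈ Finset.range t
    · simpa only [ext, h, dite_true] using measurable_pi_apply _
    · simpa only [ext, h, dite_false] using measurable_const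
  let G : S × (Finset.range t → Fin n × Fin d → ℝ) → S × History n d t :=
    fun x => A.state t (x.1, ext x.2)
  have hG : Measurable G :=
    (A.measurable_state t).comp (measurable_fst.prodMk (hext.comp measurable_snd))
  have hstate : ∀ ω, A.state t ω = G (ω.1, past ω.2) := fun ω =>
    A.state_congr t rfl fun s hs => by simp [ext, past, hs]
  have : IsProbabilityMeasure (R.map past) := Measure.isProbabilityMeasure_map hpast.aemeasurable
  have e1 : (A.prob ν).map (fun ω => (A.state t ω, ω.2 t)) =
      ((A.seedLaw : Measure S).prod (R.map fun y => (past y, y t))).map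
        (fun x => (G (x.1, x.2.1), x.2.2)) := by
    have := Measure.map_prod_map (A.seedLaw : Measure S) R measurable_id (hpast.prodMk hev)
    rw [Measure.map_id] at this
    rw [this, Measure.map_map (by fun_prop) (by fun_prop), hP]
    congr 1
    funext ω
    simp [hstate]
  have e2 : (A.prob ν).map (A.state t) = ((A.seedLaw : Measure S).prod (R.map past)).map G := by
    have := Measure.map_prod_map (A.seedLaw : Measure S) R measurable_id hpast
    rw [Measure.map_id] at this
    rw [this, Measure.map_map (by fun_prop) (by fun_prop), hP]
    congr 1
    funext ω
    exact hstate ω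
  have e3 := Measure.map_prod_map ((A.seedLaw : Measure S).prod (R.map past)) (tableLaw ν) hG
    measurable_id
  rw [Measure.map_id, ← e2] at e3
  rw [e1, hpair, e3, ← Measure.prodAssoc_prod, Measure.map_map (by fun_prop) (by fun_prop)]
  rfl

lemma measurable_state_table (A : Algorithm n d S) (t : ℕ) :
    Measurable fun ω : Outcome n d S => (A.state t ω, ω.2 t) :=
  (A.measurable_state t).prodMk ((measurable_pi_apply t).comp measurable_snd)

lemma lintegral_state_table (A : Algorithm n d S) (ν : Problem n d) (t : ℕ)
    {F : (S × History n d t) × (Fin n × Fin d → ℝ) → ℝ≥0∞} (hF : Measurable F) :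
    ∫⁻ ω, F (A.state t ω, ω.2 t) ∂(A.prob ν) =
      ∫⁻ ω, ∫⁻ y, F (A.state t ω, y) ∂(tableLaw ν) ∂(A.prob ν) := by
  rw [← lintegral_map hF (A.measurable_state_table t), map_state_table,
    lintegral_prod _ hF.aemeasurable, lintegral_map (by fun_prop) (A.measurable_state t)]

lemma lintegral_table_eval (ν : Problem n d) (q : Fin n × Fin d) {f : ℝ → ℝ≥0∞}
    (hf : Measurable f) :
    ∫⁻ y, f (y q) ∂(tableLaw ν) = ∫⁻ x, f x ∂(ν q.1 q.2 : Measure ℝ) :=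
  (measurePreserving_eval (fun p : Fin n × Fin d => (ν p.1 p.2 : Measure ℝ)) q).lintegral_comp hf

/-! ### Change of measure -/

/-- The product of the values of `r` along a history. -/
def weight (r : Fin n × Fin d → ℝ → ℝ≥0∞) {t : ℕ} (h : History n d t) : ℝ≥0∞ :=
  ∏ i, r (h i).1 (h i).2

lemma weight_snoc (r : Fin n × Fin d → ℝ → ℝ≥0∞) {t : ℕ} (h : History n d t)
    (x : (Fin n × Fin d) × ℝ) :
    weight r (Fin.snoc (α := fun _ => (Fin n × Fin d) × ℝ) h x : History n d (t + 1)) =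
      weight r h * r x.1 x.2 := by
  simp [weight, Fin.prod_univ_castSucc]

lemma measurable_uncurry_ratio {r : Fin n × Fin d → ℝ → ℝ≥0∞} (hr : ∀ q, Measurable (r q)) :
    Measurable fun x : (Fin n × Fin d) × ℝ => r x.1 x.2 :=
  measurable_from_prod_countable_right fun q => hr q

lemma measurable_weight {r : Fin n × Fin d → ℝ → ℝ≥0∞} (hr : ∀ q, Measurable (r q)) {t : ℕ} :
    Measurable (weight r (t := t)) :=
  Finset.measurable_prod _ fun i _ =>
    (measurable_uncurry_ratio hr).comp (measurable_pi_apply i)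

/-- The laws of the observations after `t` queries on two problems have the product of the
densities as a likelihood ratio. -/
lemma lintegral_state_change (A : Algorithm n d S) {ν ν' : Problem n d}
    {r : Fin n × Fin d → ℝ → ℝ≥0∞} (hr : ∀ q, Measurable (r q))
    (h : ∀ q, (ν' q.1 q.2 : Measure ℝ) = (ν q.1 q.2 : Measure ℝ).withDensity (r q)) (t : ℕ)
    {f : S × History n d t → ℝ≥0∞} (hf : Measurable f) :
    ∫⁻ ω, f (A.state t ω) ∂(A.prob ν') =
      ∫⁻ ω, f (A.state t ω) * weight r (A.history ω t) ∂(A.prob ν) := by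
  induction t with
  | zero =>
    -- Before any query only the seed is known. Its law does not depend on the problem, and the
    -- weight is an empty product.
    have e : ∀ ω : Outcome n d S, A.state 0 ω = (ω.1, Fin.elim0) := fun ω => rfl
    have hm : Measurable fun s : S => f (s, Fin.elim0) := hf.comp (by fun_prop)
    have key : ∀ μ : Problem n d, ∫⁻ ω, f (A.state 0 ω) ∂(A.prob μ) =
        ∫⁻ s, f (s, Fin.elim0) ∂(A.seedLaw : Measure S) := fun μ => by
      simp only [e]
      unfold prob
      rw [lintegral_prod _ (by fun_prop)]
      simp
    rw [key ν', ← key ν]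
    simp [weight]
  | succ t ih =>
    let F : (S × History n d t) × (Fin n × Fin d → ℝ) → ℝ≥0∞ := fun x =>
      f (x.1.1, Fin.snoc (α := fun _ => (Fin n × Fin d) × ℝ) x.1.2
        (A.query t x.1, x.2 (A.query t x.1)))
    have hqm := A.measurable_query t
    have hx : Measurable fun x : (S × History n d t) × (Fin n × Fin d → ℝ) =>
        (A.query t x.1, x.2 (A.query t x.1)) :=
      (hqm.comp measurable_fst).prodMk
        (measurable_eval_uncurry.comp (measurable_snd.prodMk (hqm.comp measurable_fst)))
    have hF : Measurable F := hf.comp ((measurable_fst.comp measurable_fst).prodMk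
      (measurable_snoc.comp ((measurable_snd.comp measurable_fst).prodMk hx)))
    have hrx : Measurable fun x : (S × History n d t) × (Fin n × Fin d → ℝ) =>
        r (A.query t x.1) (x.2 (A.query t x.1)) := (measurable_uncurry_ratio hr).comp hx
    have hw : Measurable fun x : (S × History n d t) × (Fin n × Fin d → ℝ) => weight r x.1.2 :=
      (measurable_weight hr).comp (measurable_snd.comp measurable_fst)
    have hFq : ∀ x : S × History n d t, Measurable fun z : ℝ =>
        f (x.1, Fin.snoc (α := fun _ => (Fin n × Fin d) × ℝ) x.2 (A.query t x, z)) := fun x =>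
      hf.comp (measurable_const.prodMk (measurable_snoc.comp
        (measurable_const.prodMk (measurable_const.prodMk measurable_id))))
    -- Average out the fresh table under `ν'`, apply the induction hypothesis to this average as a
    -- function of the state, then trade `ν'` for `ν` at the single queried entry, which contributes
    -- one more factor `r`.
    calc ∫⁻ ω, f (A.state (t + 1) ω) ∂(A.prob ν')
        = ∫⁻ ω, F (A.state t ω, ω.2 t) ∂(A.prob ν') := rfl
      _ = ∫⁻ ω, ∫⁻ y, F (A.state t ω, y) ∂(tableLaw ν') ∂(A.prob ν') :=
          A.lintegral_state_table ν' t hF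
      _ = ∫⁻ ω, (∫⁻ y, F (A.state t ω, y) ∂(tableLaw ν')) * weight r (A.history ω t) ∂(A.prob ν) :=
          ih (f := fun x => ∫⁻ y, F (x, y) ∂(tableLaw ν')) hF.lintegral_prod_right'
      _ = ∫⁻ ω, ∫⁻ y, F (A.state t ω, y) * (weight r (A.state t ω).2 *
            r (A.query t (A.state t ω)) (y (A.query t (A.state t ω)))) ∂(tableLaw ν) ∂(A.prob ν) := by
          refine lintegral_congr fun ω => ?_
          generalize hst : A.state t ω = x
          have hh : A.history ω t = x.2 := congrArg Prod.snd hst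
          rw [hh]
          simp only [F]
          rw [lintegral_table_eval ν' (A.query t x) (hFq x), h,
            lintegral_withDensity_eq_lintegral_mul _ (hr _) (hFq x),
            lintegral_table_eval ν (A.query t x) (f := fun z => f (x.1, Fin.snoc
              (α := fun _ => (Fin n × Fin d) × ℝ) x.2 (A.query t x, z)) *
              (weight r x.2 * r (A.query t x) z))
              ((hFq x).mul (measurable_const.mul (hr _))),
            ← lintegral_mul_const _ ((hr _).mul (hFq x))]
          refine lintegral_congr fun z => ?_
          simp only [Pi.mul_apply]
          ring
      _ = ∫⁻ ω, F (A.state t ω, ω.2 t) * (weight r (A.state t ω).2 *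
            r (A.query t (A.state t ω)) (ω.2 t (A.query t (A.state t ω)))) ∂(A.prob ν) :=
          (A.lintegral_state_table ν t (hF.mul (hw.mul hrx))).symm
      _ = _ := by
          refine lintegral_congr fun ω => ?_
          rw [history_succ, weight_snoc]
          rfl

/-! ### The stopping time -/

lemma le_numQueries_iff (A : Algorithm n d S) (k : ℕ) (ω : Outcome n d S) :
    (k : ℕ∞) ≤ A.numQueries ω ↔ ∀ s < k, A.state s ω ∉ A.stopSet s := by
  simp only [numQueries, le_iInf_iff, Nat.cast_le]
  exact ⟨fun h s hs hm => absurd (h s hm) (not_le.2 hs),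
    fun h s hm => not_lt.1 fun hs => h s hs hm⟩

/-- The states after `t` queries that come from a run which does not stop before time `k`. -/
def unstopped (A : Algorithm n d S) (t k : ℕ) : Set (S × History n d t) :=
  {x | ∀ s : Fin (t + 1), (s : ℕ) < k →
    (x.1, fun i : Fin s => x.2 (Fin.castLE (Nat.lt_succ_iff.1 s.2) i)) ∉ A.stopSet s}

lemma measurableSet_unstopped (A : Algorithm n d S) (t k : ℕ) :
    MeasurableSet (A.unstopped t k) := by
  simp only [unstopped, Set.ofPred_forall]
  refine MeasurableSet.iInter fun s => MeasurableSet.iInter fun _ => ?_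
  have : Measurable fun x : S × History n d t =>
      (x.1, fun i : Fin s => x.2 (Fin.castLE (Nat.lt_succ_iff.1 s.2) i)) :=
    measurable_fst.prodMk
      (measurable_pi_lambda _ fun i => (measurable_pi_apply _).comp measurable_snd)
  exact (this (A.measurableSet_stopSet s)).compl

/-- Whether to stop at time `s` is decided from the first `s` observations, so `t` queries settle
the event `k ≤ N` up to and including `k = t + 1`. That last case makes `running t` independent of
the sample of round `t`. -/
lemma state_mem_unstopped_iff (A : Algorithm n d S) {t k : ℕ} (hk : k ≤ t + 1)
    (ω : Outcome n d S) : A.state t ω ∈ A.unstopped t k ↔ (k : ℕ∞) ≤ A.numQueries ω := by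
  have e : ∀ s : Fin (t + 1), ((A.state t ω).1, fun i : Fin s =>
      (A.state t ω).2 (Fin.castLE (Nat.lt_succ_iff.1 s.2) i)) = A.state s ω := fun s =>
    Prod.ext rfl (funext fun i => by
      change A.history ω t _ = A.history ω s i
      rw [history_apply, history_apply]
      rfl)
  rw [le_numQueries_iff]
  simp only [unstopped, Set.mem_ofPred_eq, e]
  exact ⟨fun h s hs => h ⟨s, hs.trans_le hk⟩ hs, fun h s hs => h s hs⟩

/-- The event that a query is made in round `t`. -/
def running (A : Algorithm n d S) (t : ℕ) : Set (Outcome n d S) :=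
  {ω | (t : ℕ∞) < A.numQueries ω}

lemma running_eq (A : Algorithm n d S) (t : ℕ) :
    A.running t = A.state t ⁻¹' A.unstopped t (t + 1) := by
  ext ω
  rw [Set.mem_preimage, state_mem_unstopped_iff A le_rfl, running, Set.mem_ofPred_eq,
    Nat.cast_add, Nat.cast_one, ENat.add_one_le_iff (ENat.natCast_ne_top t)]

lemma measurableSet_running (A : Algorithm n d S) (t : ℕ) : MeasurableSet (A.running t) := by
  rw [running_eq]
  exact A.measurable_state t (A.measurableSet_unstopped _ _)

lemma numQueries_eq_tsum (A : Algorithm n d S) (ω : Outcome n d S) :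
    (A.numQueries ω : ℝ≥0∞) = ∑' t, (A.running t).indicator 1 ω := by
  rcases h : A.numQueries ω with _ | k
  · have : ∀ t, (A.running t).indicator (1 : Outcome n d S → ℝ≥0∞) ω = 1 := fun t => by
      rw [Set.indicator_of_mem]
      · rfl
      · change (t : ℕ∞) < A.numQueries ω
        rw [h]
        exact ENat.natCast_lt_top t
    simp only [this]
    rw [ENNReal.tsum_const_eq_top_of_ne_zero one_ne_zero]
    rfl
  · have : ∀ t, (A.running t).indicator (1 : Outcome n d S → ℝ≥0∞) ω = if t < k then 1 else 0 := by
      intro t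
      have e : ω ∈ A.running t ↔ t < k := by
        change (t : ℕ∞) < A.numQueries ω ↔ _
        rw [h]
        exact Nat.cast_lt
      by_cases ht : t < k <;> simp [e, ht]
    simp only [this]
    rw [tsum_eq_sum (s := Finset.range k) (by simp +contextual)]
    rw [Finset.sum_congr rfl (g := fun _ => (1 : ℝ≥0∞)) (by simp +contextual)]
    simp
    rfl

lemma expectedQueries_eq_tsum (A : Algorithm n d S) (ν : Problem n d) :
    A.expectedQueries ν = ∑' t, A.prob ν (A.running t) := by
  simp only [expectedQueries, numQueries_eq_tsum]
  rw [lintegral_tsum fun t => (measurable_one.indicator (A.measurableSet_running t)).aemeasurable]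
  simp [measurableSet_running]

lemma ae_numQueries_ne_top (A : Algorithm n d S) {ν : Problem n d}
    (h : A.expectedQueries ν ≠ ∞) : ∀ᵐ ω ∂(A.prob ν), A.numQueries ω ≠ ⊤ := by
  have hm : Measurable fun ω => (A.numQueries ω : ℝ≥0∞) := by
    simp only [numQueries_eq_tsum]
    exact Measurable.tsum fun t => measurable_one.indicator (A.measurableSet_running t)
  filter_upwards [ae_lt_top hm h] with ω hω using by simpa [lt_top_iff_ne_top] using hω

/-- The event that the pair `q` is queried in round `t`. -/
def visit (A : Algorithm n d S) (q : Fin n × Fin d) (t : ℕ) : Set (Outcome n d S) :=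
  A.running t ∩ A.queryAt t ⁻¹' {q}

/-- Both the decision to continue and the choice of the pair precede the sample of round `t`; hence
the event is independent of that sample. -/
lemma visit_eq (A : Algorithm n d S) (q : Fin n × Fin d) (t : ℕ) :
    A.visit q t = A.state t ⁻¹' (A.unstopped t (t + 1) ∩ A.query t ⁻¹' {q}) := by
  rw [visit, running_eq]
  rfl

lemma measurableSet_visit (A : Algorithm n d S) (q : Fin n × Fin d) (t : ℕ) :
    MeasurableSet (A.visit q t) :=
  (A.measurableSet_running t).inter (A.measurable_queryAt t (measurableSet_singleton q))

/-- The expected number of queries of the pair `q`. -/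
def expectedVisits (A : Algorithm n d S) (ν : Problem n d) (q : Fin n × Fin d) : ℝ≥0∞ :=
  ∑' t, A.prob ν (A.visit q t)

lemma sum_measure_visit (A : Algorithm n d S) (ν : Problem n d) (t : ℕ) :
    ∑ q, A.prob ν (A.visit q t) = A.prob ν (A.running t) := by
  rw [← tsum_fintype (L := .unconditional _), ← measure_iUnion _ fun q => A.measurableSet_visit q t]
  · congr 1
    ext ω
    simp [visit]
  · intro q q' hq
    refine Set.disjoint_left.2 fun ω h h' => hq ?_
    exact (h.2 : A.queryAt t ω = q).symm.trans h'.2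

lemma sum_expectedVisits (A : Algorithm n d S) (ν : Problem n d) :
    ∑ q, A.expectedVisits ν q = A.expectedQueries ν := by
  simp only [expectedVisits, expectedQueries_eq_tsum, ← sum_measure_visit]
  rw [Summable.tsum_finsetSum fun _ _ => ENNReal.summable]

/-! ### The log-likelihood ratio at the stopping time -/

/-- The contribution of round `t` to the cumulative loss `ℓ`. -/
def stepLoss (A : Algorithm n d S) (ℓ : Fin n × Fin d → ℝ → ℝ) (t : ℕ) (ω : Outcome n d S) : ℝ :=
  ∑ q, (A.visit q t).indicator 1 ω * ℓ q (ω.2 t q)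

/-- The cumulative loss up to the stopping time. -/
def totalLoss (A : Algorithm n d S) (ℓ : Fin n × Fin d → ℝ → ℝ) (ω : Outcome n d S) : ℝ :=
  ∑' t, A.stepLoss ℓ t ω

/-- Exactly one pair is visited in a round before stopping. Writing the step as a sum over fixed
pairs makes each term a function of the past times a function of one fresh sample. -/
lemma stepLoss_of_lt (A : Algorithm n d S) (ℓ : Fin n × Fin d → ℝ → ℝ) {t : ℕ}
    {ω : Outcome n d S} (h : (t : ℕ∞) < A.numQueries ω) :
    A.stepLoss ℓ t ω = ℓ (A.queryAt t ω) (ω.2 t (A.queryAt t ω)) := by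
  have hr : ω ∈ A.running t := h
  rw [stepLoss, Finset.sum_eq_single (A.queryAt t ω)]
  · simp [visit, hr]
  · intro q _ hq
    simp [visit, hq.symm]
  · simp

lemma stepLoss_of_le (A : Algorithm n d S) (ℓ : Fin n × Fin d → ℝ → ℝ) {t : ℕ}
    {ω : Outcome n d S} (h : A.numQueries ω ≤ t) : A.stepLoss ℓ t ω = 0 := by
  have hr : ω ∉ A.running t := not_lt.2 h
  simp [stepLoss, visit, hr]

/-- On runs that stop, the series is a finite sum over the history, which links it to `weight`. Its
value on runs that never stop is immaterial, as these are null when the expected number of queries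
is finite. -/
lemma totalLoss_eq_sum (A : Algorithm n d S) (ℓ : Fin n × Fin d → ℝ → ℝ) {t : ℕ}
    {ω : Outcome n d S} (h : A.numQueries ω = t) :
    A.totalLoss ℓ ω = ∑ s : Fin t, ℓ (A.history ω t s).1 (A.history ω t s).2 := by
  rw [totalLoss, tsum_eq_sum (s := Finset.range t), Finset.sum_range]
  · refine Finset.sum_congr rfl fun s _ => ?_
    rw [stepLoss_of_lt A ℓ (by rw [h]; exact_mod_cast s.2), history_apply]
  · intro s hs
    refine A.stepLoss_of_le ℓ ?_
    rw [h]
    exact_mod_cast not_lt.1 fun h' => hs (Finset.mem_range.2 h')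

/-! ### Wald's identity for the loss accumulated up to the stopping time. -/

section Wald

variable (A : Algorithm n d S) (ν : Problem n d) {ℓ : Fin n × Fin d → ℝ → ℝ}

/-- A function of the past times an integrable function of a fresh sample. -/
lemma integrable_and_integral_state_mul_table {t : ℕ} (B : Set (S × History n d t))
    (hB : MeasurableSet B) (q : Fin n × Fin d) {f : ℝ → ℝ}
    (hf : Integrable f (ν q.1 q.2 : Measure ℝ)) :
    Integrable (fun ω => (A.state t ⁻¹' B).indicator 1 ω * f (ω.2 t q)) (A.prob ν) ∧
      ∫ ω, (A.state t ⁻¹' B).indicator 1 ω * f (ω.2 t q) ∂(A.prob ν) =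
        (A.prob ν).real (A.state t ⁻¹' B) * ∫ x, f x ∂(ν q.1 q.2 : Measure ℝ) := by
  have : IsProbabilityMeasure ((A.prob ν).map (A.state t)) :=
    Measure.isProbabilityMeasure_map (A.measurable_state t).aemeasurable
  have hmp : MeasurePreserving (fun y : Fin n × Fin d → ℝ => y q) (tableLaw ν)
      (ν q.1 q.2 : Measure ℝ) :=
    measurePreserving_eval (fun p : Fin n × Fin d => (ν p.1 p.2 : Measure ℝ)) q
  have hg : Integrable (fun y : Fin n × Fin d → ℝ => f (y q)) (tableLaw ν) :=
    hmp.integrable_comp_of_integrable hf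
  have hi : Integrable (B.indicator (1 : S × History n d t → ℝ)) ((A.prob ν).map (A.state t)) :=
    (integrable_const (1 : ℝ)).indicator hB
  -- The law of (state, fresh table) is a product measure, so integrability and the integral both
  -- factor.
  have hprod := hi.mul_prod hg
  rw [← map_state_table] at hprod
  have hm := (A.measurable_state_table t).aemeasurable (μ := A.prob ν)
  refine ⟨hprod.comp_aemeasurable hm, ?_⟩
  have e := integral_map hm hprod.aestronglyMeasurable
  refine e.symm.trans ?_
  rw [map_state_table, integral_prod_mul (B.indicator 1) fun y : Fin n × Fin d → ℝ => f (y q)]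
  congr 1
  · rw [integral_indicator_one hB, map_measureReal_apply (A.measurable_state t) hB]
  · rw [← hmp.map_eq, integral_map hmp.measurable.aemeasurable]
    rw [hmp.map_eq]
    exact hf.aestronglyMeasurable

lemma integrable_stepLoss (hℓ : ∀ q, Integrable (ℓ q) (ν q.1 q.2 : Measure ℝ)) (t : ℕ) :
    Integrable (A.stepLoss ℓ t) (A.prob ν) := by
  refine integrable_finsetSum _ fun q _ => ?_
  rw [visit_eq]
  exact (A.integrable_and_integral_state_mul_table ν _ ((A.measurableSet_unstopped _ _).inter
    (A.measurable_query t (measurableSet_singleton q))) q (hℓ q)).1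

lemma integral_stepLoss (hℓ : ∀ q, Integrable (ℓ q) (ν q.1 q.2 : Measure ℝ)) (t : ℕ) :
    ∫ ω, A.stepLoss ℓ t ω ∂(A.prob ν) =
      ∑ q, (A.prob ν).real (A.visit q t) * ∫ x, ℓ q x ∂(ν q.1 q.2 : Measure ℝ) := by
  have h := fun q => A.integrable_and_integral_state_mul_table ν _
    ((A.measurableSet_unstopped t (t + 1)).inter
      (A.measurable_query t (measurableSet_singleton q))) q (hℓ q)
  simp only [← visit_eq] at h
  simp only [stepLoss]
  rw [integral_finsetSum _ fun q _ => (h q).1]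
  exact Finset.sum_congr rfl fun q _ => (h q).2

/-- At most one summand is nonzero, so the norm passes inside. The formula for expected steps,
applied to `‖ℓ q‖`, then gives the absolute summability needed to exchange series and integral. -/
lemma norm_stepLoss (t : ℕ) (ω : Outcome n d S) :
    ‖A.stepLoss ℓ t ω‖ = A.stepLoss (fun q x => ‖ℓ q x‖) t ω := by
  rcases lt_or_ge (t : ℕ∞) (A.numQueries ω) with h | h
  · rw [stepLoss_of_lt A _ h, stepLoss_of_lt A _ h]
  · rw [stepLoss_of_le A _ h, stepLoss_of_le A _ h, norm_zero]

variable {ν}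

lemma expectedVisits_ne_top (h : A.expectedQueries ν ≠ ∞) (q : Fin n × Fin d) :
    A.expectedVisits ν q ≠ ∞ := by
  refine ne_top_of_le_ne_top h ?_
  rw [← sum_expectedVisits]
  exact Finset.single_le_sum (f := fun q => A.expectedVisits ν q) (fun _ _ => zero_le)
    (Finset.mem_univ q)

lemma hasSum_measure_visit (h : A.expectedQueries ν ≠ ∞) (q : Fin n × Fin d) :
    HasSum (fun t => (A.prob ν).real (A.visit q t)) (A.expectedVisits ν q).toReal := by
  have hv := A.expectedVisits_ne_top h q
  rw [expectedVisits, ENNReal.tsum_toReal_eq (ENNReal.ne_top_of_tsum_ne_top hv)]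
  exact ENNReal.hasSum_toReal hv

lemma hasSum_integral_stepLoss (h : A.expectedQueries ν ≠ ∞)
    (hℓ : ∀ q, Integrable (ℓ q) (ν q.1 q.2 : Measure ℝ)) :
    HasSum (fun t => ∫ ω, A.stepLoss ℓ t ω ∂(A.prob ν))
      (∑ q, (A.expectedVisits ν q).toReal * ∫ x, ℓ q x ∂(ν q.1 q.2 : Measure ℝ)) := by
  simp only [A.integral_stepLoss ν hℓ]
  exact hasSum_sum fun q _ => (A.hasSum_measure_visit h q).mul_right _

lemma summable_integral_norm_stepLoss (h : A.expectedQueries ν ≠ ∞)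
    (hℓ : ∀ q, Integrable (ℓ q) (ν q.1 q.2 : Measure ℝ)) :
    Summable fun t => ∫ ω, ‖A.stepLoss ℓ t ω‖ ∂(A.prob ν) := by
  simp only [norm_stepLoss]
  exact (A.hasSum_integral_stepLoss h fun q => (hℓ q).norm).summable

/-- Wald's identity. -/
lemma integral_totalLoss (h : A.expectedQueries ν ≠ ∞)
    (hℓ : ∀ q, Integrable (ℓ q) (ν q.1 q.2 : Measure ℝ)) :
    ∫ ω, A.totalLoss ℓ ω ∂(A.prob ν) =
      ∑ q, (A.expectedVisits ν q).toReal * ∫ x, ℓ q x ∂(ν q.1 q.2 : Measure ℝ) :=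
  (hasSum_integral_of_summable_integral_norm (A.integrable_stepLoss ν hℓ)
    (A.summable_integral_norm_stepLoss h hℓ)).unique (A.hasSum_integral_stepLoss h hℓ)

lemma measurable_stepLoss (hℓ : ∀ q, Measurable (ℓ q)) (t : ℕ) : Measurable (A.stepLoss ℓ t) :=
  Finset.measurable_sum _ fun q _ => (measurable_one.indicator (A.measurableSet_visit q t)).mul
    ((hℓ q).comp ((measurable_pi_apply q).comp ((measurable_pi_apply t).comp measurable_snd)))

lemma measurable_totalLoss (hℓ : ∀ q, Measurable (ℓ q)) : Measurable (A.totalLoss ℓ) :=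
  Measurable.tsum fun t => A.measurable_stepLoss hℓ t

lemma integrable_totalLoss (h : A.expectedQueries ν ≠ ∞) (hm : ∀ q, Measurable (ℓ q))
    (hℓ : ∀ q, Integrable (ℓ q) (ν q.1 q.2 : Measure ℝ)) :
    Integrable (A.totalLoss ℓ) (A.prob ν) := by
  refine ⟨(A.measurable_totalLoss hm).aestronglyMeasurable, ?_⟩
  calc ∫⁻ ω, ‖A.totalLoss ℓ ω‖ₑ ∂(A.prob ν)
      ≤ ∫⁻ ω, ∑' t, ‖A.stepLoss ℓ t ω‖ₑ ∂(A.prob ν) :=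
        lintegral_mono fun ω => enorm_tsum_le_tsum_enorm
    _ = ∑' t, ∫⁻ ω, ‖A.stepLoss ℓ t ω‖ₑ ∂(A.prob ν) :=
        lintegral_tsum fun t => (A.measurable_stepLoss hm t).enorm.aemeasurable
    _ = ∑' t, ENNReal.ofReal (∫ ω, ‖A.stepLoss ℓ t ω‖ ∂(A.prob ν)) :=
        tsum_congr fun t => (ofReal_integral_norm_eq_lintegral_enorm
          (A.integrable_stepLoss ν hℓ t)).symm
    _ < ∞ := (A.summable_integral_norm_stepLoss h hℓ).tsum_ofReal_lt_top

end Wald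

end Algorithm

/-! ### Jensen and Cauchy–Schwarz inequalities for extended nonnegative integrals. -/

lemma ofReal_integral_le_lintegral_ofReal {α : Type*} [MeasurableSpace α] {μ : Measure α}
    {f : α → ℝ} (hf : Integrable f μ) :
    ENNReal.ofReal (∫ x, f x ∂μ) ≤ ∫⁻ x, ENNReal.ofReal (f x) ∂μ := by
  rw [integral_eq_lintegral_pos_part_sub_lintegral_neg_part hf]
  refine (ENNReal.ofReal_le_ofReal (sub_le_self _ ENNReal.toReal_nonneg)).trans ?_
  exact ENNReal.ofReal_toReal_le

/-- Jensen's inequality for the exponential. -/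
lemma ofReal_exp_integral_le {α : Type*} [MeasurableSpace α] {μ : Measure α}
    [IsProbabilityMeasure μ] {f : α → ℝ} (hf : Integrable f μ) :
    ENNReal.ofReal (Real.exp (∫ x, f x ∂μ)) ≤ ∫⁻ x, ENNReal.ofReal (Real.exp (f x)) ∂μ := by
  set m := ∫ x, f x ∂μ with hm
  -- The tangent line of `exp` at the mean `m` lies below `exp` and integrates to `exp m`. No
  -- integrability of `exp ∘ f` is needed.
  have hg : Integrable (fun x => Real.exp m * (f x - m + 1)) μ :=
    ((hf.sub (integrable_const m)).add (integrable_const 1)).const_mul _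
  have hint : ∫ x, Real.exp m * (f x - m + 1) ∂μ = Real.exp m := by
    have hs : ∫ x, (f x - m) ∂μ = 0 := by
      rw [integral_sub hf (integrable_const m), ← hm]
      simp
    rw [integral_const_mul, integral_add (f := fun x => f x - m)
      (hf.sub (integrable_const m)) (integrable_const 1), hs]
    simp
  calc ENNReal.ofReal (Real.exp m)
      = ENNReal.ofReal (∫ x, Real.exp m * (f x - m + 1) ∂μ) := by rw [hint]
    _ ≤ ∫⁻ x, ENNReal.ofReal (Real.exp m * (f x - m + 1)) ∂μ :=
        ofReal_integral_le_lintegral_ofReal hg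
    _ ≤ _ := lintegral_mono fun x => ENNReal.ofReal_le_ofReal <| by
        calc Real.exp m * (f x - m + 1) ≤ Real.exp m * Real.exp (f x - m) :=
              mul_le_mul_of_nonneg_left (Real.add_one_le_exp _) (Real.exp_pos _).le
          _ = Real.exp (f x) := by rw [← Real.exp_add]; ring_nf

/-- The Cauchy–Schwarz inequality for the square root of a function on a set. -/
lemma setLIntegral_sqrt_le {α : Type*} [MeasurableSpace α] (μ : Measure α) (E : Set α)
    {f : α → ℝ≥0∞} (hf : Measurable f) :
    ∫⁻ x in E, f x ^ (1 / 2 : ℝ) ∂μ ≤ (μ E * ∫⁻ x in E, f x ∂μ) ^ (1 / 2 : ℝ) := by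
  have h := ENNReal.lintegral_mul_le_Lp_mul_Lq (μ.restrict E) Real.HolderConjugate.two_two
    (f := 1) (g := fun x => f x ^ (1 / 2 : ℝ)) aemeasurable_const (hf.pow_const _).aemeasurable
  simp only [one_mul, Pi.one_apply, ENNReal.one_rpow, lintegral_const, Measure.restrict_apply_univ,
    ← ENNReal.rpow_mul] at h
  rw [ENNReal.mul_rpow_of_nonneg _ _ (by norm_num)]
  simpa using h

namespace Algorithm

variable {n d : ℕ} {S : Type*} [MeasurableSpace S]

/-! ### The answer -/

/-- The event that the algorithm stops and its answer is in `C`. -/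
def answersIn (A : Algorithm n d S) (C : Set (Fin n)) : Set (Outcome n d S) :=
  {ω | ∃ t : ℕ, A.numQueries ω = t ∧ A.answer t (A.state t ω) ∈ C}

lemma output_of_numQueries_eq (A : Algorithm n d S) {ω : Outcome n d S} {t : ℕ}
    (h : A.numQueries ω = t) : A.output ω = some (A.answer t (A.state t ω)) := by
  rw [output, if_neg (by rw [h]; exact ENat.natCast_ne_top t), h]
  rfl

/-- The states after `t` queries at which the algorithm has just stopped with an answer in `C`. -/
def stopAnswer (A : Algorithm n d S) (C : Set (Fin n)) (t : ℕ) : Set (S × History n d t) :=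
  (A.unstopped t t \ A.unstopped t (t + 1)) ∩ A.answer t ⁻¹' C

lemma measurableSet_stopAnswer (A : Algorithm n d S) (C : Set (Fin n)) (t : ℕ) :
    MeasurableSet (A.stopAnswer C t) :=
  ((A.measurableSet_unstopped _ _).diff (A.measurableSet_unstopped _ _)).inter
    (A.measurable_answer t MeasurableSet.of_discrete)

/-- Stopping exactly at `t` means `t ≤ N` but not `t + 1 ≤ N`, and both are read off the state after
`t` queries. -/
lemma state_mem_stopAnswer_iff (A : Algorithm n d S) (C : Set (Fin n)) (t : ℕ)
    (ω : Outcome n d S) : A.state t ω ∈ A.stopAnswer C t ↔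
      A.numQueries ω = t ∧ A.answer t (A.state t ω) ∈ C := by
  rw [stopAnswer, Set.mem_inter_iff, Set.mem_sdiff, state_mem_unstopped_iff A (Nat.le_succ t),
    state_mem_unstopped_iff A le_rfl, Nat.cast_add, Nat.cast_one,
    ENat.add_one_le_iff (ENat.natCast_ne_top t), not_lt, ← le_antisymm_iff, eq_comm]
  rfl

lemma answersIn_eq (A : Algorithm n d S) (C : Set (Fin n)) :
    A.answersIn C = ⋃ t, A.state t ⁻¹' A.stopAnswer C t := by
  ext ω
  simp [answersIn, state_mem_stopAnswer_iff]

lemma pairwise_disjoint_stopAnswer (A : Algorithm n d S) (C : Set (Fin n)) :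
    Pairwise (Function.onFun Disjoint fun t => A.state t ⁻¹' A.stopAnswer C t) := by
  intro t t' ht
  refine Set.disjoint_left.2 fun ω h h' => ht ?_
  have h1 := ((A.state_mem_stopAnswer_iff C t ω).1 h).1
  have h2 := ((A.state_mem_stopAnswer_iff C t' ω).1 h').1
  exact Nat.cast_injective (R := ℕ∞) (h1.symm.trans h2)

lemma measurableSet_answersIn (A : Algorithm n d S) (C : Set (Fin n)) :
    MeasurableSet (A.answersIn C) := by
  rw [answersIn_eq]
  exact MeasurableSet.iUnion fun t => A.measurable_state t (A.measurableSet_stopAnswer C t)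

lemma prob_answersIn_le (A : Algorithm n d S) {ν : Problem n d} {a : Fin n} {C : Set (Fin n)}
    (ha : a ∉ C) {ε : ℝ≥0∞} (h : A.prob ν {ω | A.output ω ≠ some a} ≤ ε) :
    A.prob ν (A.answersIn C) ≤ ε := by
  refine (measure_mono ?_).trans h
  rintro ω ⟨t, ht, hC⟩
  change A.output ω ≠ some a
  rw [A.output_of_numQueries_eq ht, Ne, Option.some_inj]
  rintro rfl
  exact ha hC

/-- A run that stops answers in exactly one of `C` and `Cᶜ`; only never stopping escapes both. -/
lemma compl_answersIn (A : Algorithm n d S) (C : Set (Fin n)) {ω : Outcome n d S}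
    (hω : A.numQueries ω ≠ ⊤) : ω ∈ (A.answersIn C)ᶜ ↔ ω ∈ A.answersIn Cᶜ := by
  obtain ⟨t, ht⟩ := ENat.ne_top_iff_exists.1 hω
  have key : ∀ C, ω ∈ A.answersIn C ↔ A.answer t (A.state t ω) ∈ C := fun C => by
    refine ⟨?_, fun h => ⟨t, ht.symm, h⟩⟩
    rintro ⟨t', ht', h⟩
    obtain rfl : t = t' := Nat.cast_injective (R := ℕ∞) (ht.trans ht')
    exact h
  rw [Set.mem_compl_iff, key, key, Set.mem_compl_iff]

/-! ### The information inequality -/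

variable (A : Algorithm n d S) {ν ν' : Problem n d} {ℓ : Fin n × Fin d → ℝ → ℝ}

/-- The likelihood ratio at the stopping time changes the measure. -/
lemma setLIntegral_exp_neg_totalLoss (hm : ∀ q, Measurable (ℓ q))
    (h : ∀ q, (ν' q.1 q.2 : Measure ℝ) = (ν q.1 q.2 : Measure ℝ).withDensity
      fun x => ENNReal.ofReal (Real.exp (-ℓ q x))) (C : Set (Fin n)) :
    ∫⁻ ω in A.answersIn C, ENNReal.ofReal (Real.exp (-A.totalLoss ℓ ω)) ∂(A.prob ν) =
      A.prob ν' (A.answersIn C) := by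
  have hms := fun t => A.measurable_state t (A.measurableSet_stopAnswer C t)
  -- Split by the stopping time. On the piece `N = t` the exponential is the weight of the history,
  -- so the fixed-time change of measure applies.
  rw [answersIn_eq, lintegral_iUnion hms (A.pairwise_disjoint_stopAnswer C),
    measure_iUnion (A.pairwise_disjoint_stopAnswer C) hms]
  refine tsum_congr fun t => ?_
  have hc := A.lintegral_state_change (fun q => (hm q).neg.exp.ennreal_ofReal) h t
    (f := (A.stopAnswer C t).indicator 1)
    (measurable_one.indicator (A.measurableSet_stopAnswer C t))
  have hl : ∀ ω, (A.stopAnswer C t).indicator (1 : S × History n d t → ℝ≥0∞) (A.state t ω) =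
      (A.state t ⁻¹' A.stopAnswer C t).indicator 1 ω := fun ω => rfl
  simp only [hl] at hc
  rw [lintegral_indicator_one (hms t)] at hc
  rw [hc, ← lintegral_indicator (hms t)]
  refine lintegral_congr fun ω => ?_
  by_cases hω : ω ∈ A.state t ⁻¹' A.stopAnswer C t
  · rw [Set.indicator_of_mem hω, Set.indicator_of_mem hω, Pi.one_apply, one_mul,
      A.totalLoss_eq_sum ℓ ((A.state_mem_stopAnswer_iff C t ω).1 hω).1, weight,
      ← Finset.sum_neg_distrib, Real.exp_sum,
      ENNReal.ofReal_prod_of_nonneg fun _ _ => (Real.exp_pos _).le]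
    rfl
  · rw [Set.indicator_of_notMem hω, Set.indicator_of_notMem hω, zero_mul]

/-- If the algorithm tells two problems apart with error probability `δ`, then the expected
log-likelihood ratio between them is at least `log (1 / (4 * δ))`. -/
theorem log_le_sum_expectedVisits {δ : ℝ} (hδ : 0 < δ) {a b : Fin n} (hab : a ≠ b)
    (ha : A.prob ν {ω | A.output ω ≠ some a} ≤ ENNReal.ofReal δ)
    (hb : A.prob ν' {ω | A.output ω ≠ some b} ≤ ENNReal.ofReal δ)
    (hN : A.expectedQueries ν ≠ ∞) (hm : ∀ q, Measurable (ℓ q))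
    (hℓ : ∀ q, Integrable (ℓ q) (ν q.1 q.2 : Measure ℝ))
    (h : ∀ q, (ν' q.1 q.2 : Measure ℝ) = (ν q.1 q.2 : Measure ℝ).withDensity
      fun x => ENNReal.ofReal (Real.exp (-ℓ q x))) :
    Real.log (1 / (4 * δ)) ≤
      ∑ q, (A.expectedVisits ν q).toReal * ∫ x, ℓ q x ∂(ν q.1 q.2 : Measure ℝ) := by
  rw [← A.integral_totalLoss hN hℓ]
  set m := ∫ ω, A.totalLoss ℓ ω ∂(A.prob ν)
  let Z : Outcome n d S → ℝ≥0∞ := fun ω => ENNReal.ofReal (Real.exp (-A.totalLoss ℓ ω))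
  have hZ : Measurable Z := (A.measurable_totalLoss hm).neg.exp.ennreal_ofReal
  have hsqrt : ∀ x : ℝ, ENNReal.ofReal (Real.exp x) ^ (1 / 2 : ℝ) =
      ENNReal.ofReal (Real.exp (x / 2)) := fun x => by
    rw [ENNReal.ofReal_rpow_of_pos (Real.exp_pos _), ← Real.exp_mul]
    ring_nf
  have hI : Integrable (fun ω => -A.totalLoss ℓ ω / 2) (A.prob ν) :=
    (A.integrable_totalLoss hN hm hℓ).neg.div_const 2
  have hmI : ∫ ω, -A.totalLoss ℓ ω / 2 ∂(A.prob ν) = -m / 2 := by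
    rw [integral_div, integral_neg]
  -- Jensen bounds the affinity `E[√Z]` below by `exp (-m / 2)`. The rest bounds it above by `2 *
  -- √δ`, splitting according to whether the answer is `a`.
  have h1 : ENNReal.ofReal (Real.exp (-m / 2)) ≤ ∫⁻ ω, Z ω ^ (1 / 2 : ℝ) ∂(A.prob ν) := by
    simp only [Z, hsqrt]
    rw [← hmI]
    exact ofReal_exp_integral_le hI
  have h2 : ∀ C, ∫⁻ ω in A.answersIn C, Z ω ∂(A.prob ν) = A.prob ν' (A.answersIn C) :=
    A.setLIntegral_exp_neg_totalLoss hm h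
  have hae : ((A.answersIn {a})ᶜ : Set (Outcome n d S)) =ᵐ[A.prob ν] (A.answersIn {a}ᶜ : Set (Outcome n d S)) := by
    filter_upwards [A.ae_numQueries_ne_top hN] with ω hω
    exact propext (A.compl_answersIn {a} hω)
  -- Answering `a` is an error on `ν'`.
  have h3 : ∫⁻ ω in A.answersIn {a}, Z ω ^ (1 / 2 : ℝ) ∂(A.prob ν) ≤
      ENNReal.ofReal δ ^ (1 / 2 : ℝ) := by
    refine (setLIntegral_sqrt_le _ _ hZ).trans (ENNReal.rpow_le_rpow ?_ (by norm_num))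
    rw [h2, ← one_mul (ENNReal.ofReal δ)]
    exact mul_le_mul' prob_le_one (A.prob_answersIn_le (by simpa using hab.symm) hb)
  -- Any other answer is an error on `ν`.
  have h4 : ∫⁻ ω in A.answersIn {a}ᶜ, Z ω ^ (1 / 2 : ℝ) ∂(A.prob ν) ≤
      ENNReal.ofReal δ ^ (1 / 2 : ℝ) := by
    refine (setLIntegral_sqrt_le _ _ hZ).trans (ENNReal.rpow_le_rpow ?_ (by norm_num))
    rw [h2, ← mul_one (ENNReal.ofReal δ)]
    exact mul_le_mul' (A.prob_answersIn_le (by simp) ha) prob_le_one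
  have h5 : ENNReal.ofReal (Real.exp (-m / 2)) ≤ ENNReal.ofReal (2 * √δ) := by
    rw [← lintegral_add_compl _ (A.measurableSet_answersIn {a}), Measure.restrict_congr_set hae] at h1
    refine (h1.trans (add_le_add h3 h4)).trans_eq ?_
    rw [ENNReal.ofReal_rpow_of_pos hδ, ← ENNReal.ofReal_add (by positivity) (by positivity),
      Real.sqrt_eq_rpow, two_mul]
  have h6 := (ENNReal.ofReal_le_ofReal_iff (by positivity)).1 h5
  have h7 : Real.exp (-m) ≤ 4 * δ := by
    calc Real.exp (-m) = Real.exp (-m / 2) ^ 2 := by rw [sq, ← Real.exp_add]; ring_nf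
      _ ≤ (2 * √δ) ^ 2 := pow_le_pow_left₀ (Real.exp_pos _).le h6 2
      _ = 4 * δ := by rw [mul_pow, Real.sq_sqrt hδ.le]; norm_num
  rw [one_div, Real.log_inv, neg_le, Real.le_log_iff_exp_le (by positivity)]
  exact h7

end Algorithm

/-! ### Gaussian problems -/

/-- The problem with unit variance Gaussian performances and mean matrix `M`. -/
def gaussianProblem {n d : ℕ} (M : Matrix (Fin n) (Fin d) ℝ) : Problem n d :=
  fun i j => ⟨gaussianReal (M i j) 1, inferInstance⟩

lemma mean_gaussianProblem {n d : ℕ} (M : Matrix (Fin n) (Fin d) ℝ) :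
    (gaussianProblem M).mean = M := by
  ext i j
  exact integral_id_gaussianReal

lemma isSubGaussian_gaussianProblem {n d : ℕ} (M : Matrix (Fin n) (Fin d) ℝ) :
    (gaussianProblem M).IsSubGaussian := by
  intro i j
  rw [mean_gaussianProblem]
  change HasSubgaussianMGF (fun x : ℝ => x - M i j) 1 (gaussianReal (M i j) 1)
  have hmap : (gaussianReal (M i j) 1).map (fun x => x - M i j) = gaussianReal 0 1 := by
    rw [gaussianReal_map_sub_const, sub_self]
  have hm : Measurable fun x : ℝ => x - M i j := by fun_prop
  refine ⟨fun t => ?_, fun t => ?_⟩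
  · have h := integrable_exp_mul_gaussianReal (μ := 0) (v := 1) t
    rw [← hmap] at h
    exact h.comp_measurable hm
  · rw [mgf_gaussianReal hmap]
    simp

/-- The log-likelihood ratio of two unit variance Gaussian laws with means `μ` and `μ'`. -/
def gaussianLoss (μ μ' x : ℝ) : ℝ := (μ - μ') * (x - μ) + (μ - μ') ^ 2 / 2

lemma measurable_gaussianLoss (μ μ' : ℝ) : Measurable (gaussianLoss μ μ') := by
  unfold gaussianLoss; fun_prop

lemma integrable_sub_gaussianReal (μ : ℝ) :
    Integrable (fun x => x - μ) (gaussianReal μ 1) :=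
  ((memLp_id_gaussianReal 1).integrable le_rfl).sub (integrable_const μ)

lemma integrable_gaussianLoss (μ μ' : ℝ) :
    Integrable (gaussianLoss μ μ') (gaussianReal μ 1) :=
  ((integrable_sub_gaussianReal μ).const_mul _).add (integrable_const _)

/-- The linear term is centred, which leaves the Kullback–Leibler divergence of the two Gaussians:
the information in one query. -/
lemma integral_gaussianLoss (μ μ' : ℝ) :
    ∫ x, gaussianLoss μ μ' x ∂(gaussianReal μ 1) = (μ - μ') ^ 2 / 2 := by
  have h : ∫ x, (x - μ) ∂(gaussianReal μ 1) = 0 := by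
    have hi : Integrable (fun x : ℝ => x) (gaussianReal μ 1) :=
      (memLp_id_gaussianReal 1).integrable le_rfl
    rw [integral_sub hi (integrable_const μ), integral_id_gaussianReal]
    simp
  unfold gaussianLoss
  rw [integral_add ((integrable_sub_gaussianReal μ).const_mul _) (integrable_const _),
    integral_const_mul, h]
  simp

/-- Expanding the square of `x - μ' = (x - μ) + (μ - μ')` shows that `gaussianLoss` is the
difference of the two exponents. -/
lemma gaussianReal_eq_withDensity (μ μ' : ℝ) :
    gaussianReal μ' 1 = (gaussianReal μ 1).withDensity
      fun x => ENNReal.ofReal (Real.exp (-gaussianLoss μ μ' x)) := by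
  have hm : Measurable fun x => ENNReal.ofReal (Real.exp (-gaussianLoss μ μ' x)) :=
    (measurable_gaussianLoss μ μ').neg.exp.ennreal_ofReal
  rw [gaussianReal_of_var_ne_zero μ' one_ne_zero, gaussianReal_of_var_ne_zero μ one_ne_zero,
    ← withDensity_mul _ (measurable_gaussianPDF μ 1) hm]
  congr 1
  funext x
  rw [Pi.mul_apply, gaussianPDF_def, gaussianPDF_def,
    ← ENNReal.ofReal_mul (gaussianPDFReal_nonneg μ 1 x), gaussianPDFReal_def, gaussianPDFReal_def,
    gaussianLoss]
  beta_reduce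
  rw [mul_assoc _ (Real.exp _), ← Real.exp_add]
  congr 3
  simp only [NNReal.coe_one]
  ring

/-- The information inequality for Gaussian problems. -/
lemma Algorithm.log_le_sum_sq {n d : ℕ} {S : Type*} [MeasurableSpace S] (A : Algorithm n d S)
    {M M' : Matrix (Fin n) (Fin d) ℝ} {δ : ℝ} (hδ : 0 < δ) {a b : Fin n} (hab : a ≠ b)
    (ha : A.prob (gaussianProblem M) {ω | A.output ω ≠ some a} ≤ ENNReal.ofReal δ)
    (hb : A.prob (gaussianProblem M') {ω | A.output ω ≠ some b} ≤ ENNReal.ofReal δ)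
    (hN : A.expectedQueries (gaussianProblem M) ≠ ∞) :
    Real.log (1 / (4 * δ)) ≤ ∑ q : Fin n × Fin d,
      (A.expectedVisits (gaussianProblem M) q).toReal * ((M q.1 q.2 - M' q.1 q.2) ^ 2 / 2) := by
  have h := A.log_le_sum_expectedVisits hδ hab ha hb hN
    (ℓ := fun q => gaussianLoss (M q.1 q.2) (M' q.1 q.2)) (fun q => measurable_gaussianLoss _ _)
    (fun q => integrable_gaussianLoss _ _) (fun q => gaussianReal_eq_withDensity _ _)
  refine h.trans_eq (Finset.sum_congr rfl fun q _ => ?_)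
  congr 1
  exact integral_gaussianLoss _ _

/-! ### The hard problem and its alternatives -/

/-- The mean of the expert `k` in the hard problem, with gaps `g`. -/
def hardRow {m : ℕ} (g : Fin m → ℝ) : Fin (m + 1) → ℝ := Fin.cons 1 fun k => 1 - g k

/-- The means in the alternative where expert `i + 1` has mean `1` and expert `0` has
mean `1 - ε`. -/
def altRow {m : ℕ} (g : Fin m → ℝ) (i : Fin m) (ε : ℝ) : Fin (m + 1) → ℝ :=
  Function.update (Fin.cons (1 - ε) fun k => 1 - g k) i.succ 1

/-- The matrix with the value `b k` throughout the row `k`. -/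
def constRows {n : ℕ} (d : ℕ) (b : Fin n → ℝ) : Matrix (Fin n) (Fin d) ℝ := fun k _ => b k

section

variable {m d : ℕ} {g : Fin m → ℝ}

lemma isAdmissible_hardRow (hd : 1 ≤ d) (hpos : ∀ k, 0 < g k) (hle : ∀ k, g k ≤ 1)
    (hg : Monotone g) : IsAdmissible (constRows d (hardRow g)) 1 where
  monotone k _ := by
    change hardRow g k.succ ≤ hardRow g k.castSucc
    rcases Fin.eq_zero_or_eq_succ k.castSucc with h | ⟨k', h⟩
    · simp [h, hardRow, (hpos k).le]
    · have : k' ≤ k := by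
        have := congrArg Fin.val h
        simp only [Fin.val_castSucc, Fin.val_succ] at this
        exact Fin.le_def.2 (by omega)
      simpa only [h, hardRow, Fin.cons_succ] using sub_le_sub_left (hg this) 1
  bounded k _ := by
    change hardRow g k ∈ Set.Icc (0 : ℝ) 1
    refine Fin.cases ?_ (fun k => ?_) k
    · simp [hardRow]
    · simpa [hardRow] using ⟨hle k, (hpos k).le⟩
  identifiable k := ⟨⟨0, hd⟩, by
    change hardRow g k.succ ≠ hardRow g 0
    simpa [hardRow] using (hpos k).ne'⟩

lemma altRow_le_one (hpos : ∀ k, 0 < g k) (i : Fin m) {ε : ℝ} (hε : 0 < ε) (k : Fin (m + 1)) :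
    altRow g i ε k ≤ 1 := by
  by_cases h : k = i.succ
  · simp [altRow, h]
  · rw [altRow, Function.update_of_ne h]
    refine Fin.cases ?_ (fun k => ?_) k
    · simpa using hε.le
    · simpa using (hpos k).le

/-- The permutation moves `i + 1` to the front and keeps the other experts in order. Since `ε ≤ g k`
for all `k`, expert `0` still dominates the rest and comes second; `0 < ε` keeps it distinct from
the new best expert. -/
lemma isAdmissible_altRow (hd : 1 ≤ d) (hpos : ∀ k, 0 < g k) (hle : ∀ k, g k ≤ 1)
    (hg : Monotone g) (i : Fin m) {ε : ℝ} (hε : 0 < ε) (hεg : ∀ k, ε ≤ g k) :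
    IsAdmissible (constRows d (altRow g i ε)) i.succ.cycleRange.symm where
  monotone k _ := by
    change altRow g i ε _ ≤ altRow g i ε _
    rcases Fin.eq_zero_or_eq_succ k.castSucc with h | ⟨k', h⟩
    · rw [h, Fin.cycleRange_symm_zero]
      refine (altRow_le_one hpos i hε _).trans_eq ?_
      simp [altRow]
    · rw [h, Fin.cycleRange_symm_succ, Fin.cycleRange_symm_succ, altRow,
        Function.update_of_ne (Fin.succAbove_ne _ _), Function.update_of_ne (Fin.succAbove_ne _ _)]
      have hk : k' < k := by
        have := congrArg Fin.val h
        simp only [Fin.val_castSucc, Fin.val_succ] at this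
        exact Fin.lt_def.2 (by omega)
      have hlt : i.succ.succAbove k' < i.succ.succAbove k :=
        (Fin.strictMono_succAbove i.succ) hk
      generalize i.succ.succAbove k' = x at hlt ⊢
      generalize i.succ.succAbove k = y at hlt ⊢
      rcases Fin.eq_zero_or_eq_succ y with rfl | ⟨y, rfl⟩
      · exact absurd hlt (Fin.not_lt_zero x)
      rcases Fin.eq_zero_or_eq_succ x with rfl | ⟨x, rfl⟩
      · simpa only [Fin.cons_zero, Fin.cons_succ] using sub_le_sub_left (hεg y) 1
      · simpa only [Fin.cons_succ] using sub_le_sub_left (hg (Fin.succ_lt_succ_iff.1 hlt).le) 1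
  bounded k _ := by
    refine ⟨?_, altRow_le_one hpos i hε k⟩
    change 0 ≤ altRow g i ε k
    by_cases h : k = i.succ
    · simp [altRow, h]
    · rw [altRow, Function.update_of_ne h]
      refine Fin.cases ?_ (fun k => ?_) k
      · simpa using (hεg i).trans (hle i)
      · simpa using hle k
  identifiable k := ⟨⟨0, hd⟩, by
    change altRow g i ε _ ≠ altRow g i ε _
    rw [Fin.cycleRange_symm_zero, Fin.cycleRange_symm_succ, altRow,
      Function.update_of_ne (Fin.succAbove_ne _ _), Function.update_self]
    refine Fin.cases ?_ (fun k => ?_) (i.succ.succAbove k)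
    · simpa using hε.ne'
    · simpa using (hpos k).ne'⟩

/-- Only rows `0` and `i + 1` change. Charging `ε ^ 2` to every row is wasteful but harmless, as `ε`
is chosen small against the total number of visits. -/
lemma sq_hardRow_sub_altRow_le (i : Fin m) (ε : ℝ) (k : Fin (m + 1)) :
    (hardRow g k - altRow g i ε k) ^ 2 ≤ (if k = i.succ then g i ^ 2 else 0) + ε ^ 2 := by
  by_cases h : k = i.succ
  · simpa [h, hardRow, altRow] using sq_nonneg ε
  · rw [altRow, Function.update_of_ne h, if_neg h, hardRow]
    refine Fin.cases ?_ (fun k => ?_) k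
    · simp
    · simpa using sq_nonneg ε

end

/-! ### The lower bound on the hard problem. -/

/-- An accurate algorithm queries expert `i + 1` often on the hard problem. -/
lemma Algorithm.log_div_sq_le_sum_expectedVisits {m d : ℕ} (hd : 1 ≤ d) {g : Fin m → ℝ}
    (hpos : ∀ k, 0 < g k) (hle : ∀ k, g k ≤ 1) (hg : Monotone g) {δ : ℝ} (hδ : 0 < δ)
    (hδ' : δ < 1 / 4) {S : Type*} [MeasurableSpace S] (A : Algorithm (m + 1) d S)
    (hA : A.IsAccurate δ)
    (hN : A.expectedQueries (gaussianProblem (constRows d (hardRow g))) ≠ ∞) (i : Fin m) :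
    1 / g i ^ 2 * Real.log (1 / (4 * δ)) ≤
      ∑ j, (A.expectedVisits (gaussianProblem (constRows d (hardRow g))) (i.succ, j)).toReal := by
  set ν := gaussianProblem (constRows d (hardRow g)) with hν
  set L := Real.log (1 / (4 * δ))
  have hL : 0 < L := Real.log_pos (by rw [lt_div_iff₀ (by positivity)]; linarith)
  set V : Fin (m + 1) × Fin d → ℝ := fun q => (A.expectedVisits ν q).toReal
  have hV : ∀ q, 0 ≤ V q := fun q => ENNReal.toReal_nonneg
  -- `ε` may depend on the algorithm, because `V` is computed on the hard problem, before the
  -- alternative is fixed. The second condition limits the total contribution of the `ε` terms to `L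
  -- / 2`.
  obtain ⟨ε, ⟨hεg, hεL⟩, hε⟩ : ∃ ε : ℝ, ((∀ k, ε ≤ g k) ∧ ε ^ 2 * ∑ q, V q ≤ L) ∧ 0 < ε := by
    have h1 : ∀ᶠ ε : ℝ in nhds 0, ∀ k, ε ≤ g k :=
      Filter.eventually_all.2 fun k => eventually_le_nhds (hpos k)
    have h2 : ∀ᶠ ε : ℝ in nhds 0, ε ^ 2 * ∑ q, V q ≤ L := by
      have : Filter.Tendsto (fun ε : ℝ => ε ^ 2 * ∑ q, V q) (nhds 0) (nhds (0 ^ 2 * ∑ q, V q)) :=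
        Continuous.tendsto (by fun_prop) 0
      exact this.eventually_le_const (by simpa using hL)
    exact (((h1.and h2).filter_mono nhdsWithin_le_nhds).and
      (self_mem_nhdsWithin : ∀ᶠ ε : ℝ in nhdsWithin 0 (Set.Ioi 0), 0 < ε)).exists
  have ha := hA ν 1 (isSubGaussian_gaussianProblem _)
    (by rw [mean_gaussianProblem]; exact isAdmissible_hardRow hd hpos hle hg)
  have hb := hA (gaussianProblem (constRows d (altRow g i ε))) i.succ.cycleRange.symm
    (isSubGaussian_gaussianProblem _)
    (by rw [mean_gaussianProblem]; exact isAdmissible_altRow hd hpos hle hg i hε hεg)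
  rw [Fin.cycleRange_symm_zero] at hb
  have key := A.log_le_sum_sq hδ (Fin.succ_ne_zero i).symm ha hb hN
  have hbound : ∑ q : Fin (m + 1) × Fin d, V q * ((constRows d (hardRow g) q.1 q.2 -
      constRows d (altRow g i ε) q.1 q.2) ^ 2 / 2) ≤
      g i ^ 2 / 2 * ∑ j, V (i.succ, j) + ε ^ 2 * (∑ q, V q) / 2 := by
    calc _ ≤ ∑ q : Fin (m + 1) × Fin d,
          (V q * (if q.1 = i.succ then g i ^ 2 / 2 else 0) + V q * (ε ^ 2 / 2)) := by
          refine Finset.sum_le_sum fun q _ => ?_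
          rw [← mul_add]
          refine mul_le_mul_of_nonneg_left ?_ (hV q)
          have := sq_hardRow_sub_altRow_le (g := g) i ε q.1
          change (hardRow g q.1 - altRow g i ε q.1) ^ 2 / 2 ≤ _
          split_ifs at this ⊢ <;> linarith
      _ = _ := by
          rw [Finset.sum_add_distrib, ← Finset.sum_mul, Fintype.sum_prod_type,
            Finset.sum_eq_single i.succ]
          · simp only [if_true, ← Finset.sum_mul]
            ring
          · intro k _ hk
            simp [hk]
          · simp
  -- From `L ≤ g i ^ 2 / 2 * ∑ j, V (i.succ, j) + L / 2`: the factor `1 / 2` of the divergence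
  -- absorbs the loss of half of `L`.
  have hfinal : L ≤ g i ^ 2 * ∑ j, V (i.succ, j) := by linarith [key.trans hbound]
  have hgi := hpos i
  rw [div_mul_eq_mul_div, one_mul, div_le_iff₀ (by positivity), mul_comm]
  exact hfinal

/-- Some Gaussian problem of the class is hard for every accurate algorithm. -/
theorem exists_mem_gapClass_le_expectedQueries {m d : ℕ} (hd : 1 ≤ d) {δ : ℝ} (hδ : δ ∈ Set.Ioo (0 : ℝ) 1)
    (Δ : Fin m → ℝ) (hΔ_pos : ∀ i, 0 < Δ i) (hΔ_mono : Monotone Δ)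
    (hΔ_le : ∀ i, Δ i ^ 2 ≤ (d : ℝ))
    {S : Type*} [MeasurableSpace S] (A : Algorithm (m + 1) d S)
    (hA : A.IsAccurate δ) :
    ∃ ν ∈ gapClass d Δ,
      ENNReal.ofReal (∑ i : Fin m, (d : ℝ) / Δ i ^ 2 * Real.log (1 / (4 * δ))) ≤
        A.expectedQueries ν := by
  have hd0 : (0 : ℝ) < d := by exact_mod_cast hd
  -- Chosen so that `d * g i ^ 2 = Δ i ^ 2`; the hypothesis `Δ i ^ 2 ≤ d` keeps all means in `[0,
  -- 1]`.
  set g : Fin m → ℝ := fun i => Δ i / √d with hg_def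
  have hpos : ∀ k, 0 < g k := fun k => div_pos (hΔ_pos k) (Real.sqrt_pos.2 hd0)
  have hle : ∀ k, g k ≤ 1 := fun k =>
    (div_le_one (Real.sqrt_pos.2 hd0)).2 (Real.le_sqrt_of_sq_le (hΔ_le k))
  have hg : Monotone g := fun k l h => div_le_div_of_nonneg_right (hΔ_mono h) (Real.sqrt_nonneg _)
  have hsq : ∀ k, g k ^ 2 = Δ k ^ 2 / d := fun k => by
    rw [hg_def, div_pow, Real.sq_sqrt hd0.le]
  refine ⟨gaussianProblem (constRows d (hardRow g)), ⟨isSubGaussian_gaussianProblem _, 1, ?_, ?_⟩,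
    ?_⟩
  · rw [mean_gaussianProblem]
    exact isAdmissible_hardRow hd hpos hle hg
  · intro i
    rw [mean_gaussianProblem]
    have : rowSqDist (constRows d (hardRow g)) 0 i.succ = d * g i ^ 2 := by
      simp [rowSqDist, constRows, hardRow]
    refine le_of_eq ?_
    rw [Equiv.Perm.one_apply, Equiv.Perm.one_apply, this, hsq]
    field_simp
  -- For `δ ≥ 1 / 4` the logarithm is nonpositive and the claim is trivial; so it is if the expected
  -- number of queries is infinite.
  rcases le_or_gt (1 / 4) δ with hδ' | hδ'
  · have hL : Real.log (1 / (4 * δ)) ≤ 0 := by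
      have := hδ.1
      exact Real.log_nonpos (by positivity) ((div_le_one (by positivity)).2 (by linarith))
    rw [ENNReal.ofReal_of_nonpos]
    · exact zero_le
    · exact Finset.sum_nonpos fun i _ => mul_nonpos_of_nonneg_of_nonpos (by positivity) hL
  by_cases hN : A.expectedQueries (gaussianProblem (constRows d (hardRow g))) = ∞
  · rw [hN]
    exact le_top
  refine ENNReal.ofReal_le_of_le_toReal ?_
  rw [← A.sum_expectedVisits, ENNReal.toReal_sum fun q _ => A.expectedVisits_ne_top hN q,
    Fintype.sum_prod_type, Fin.sum_univ_succ]
  -- The queries of expert `0` are discarded.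
  refine le_add_of_nonneg_of_le (Finset.sum_nonneg fun _ _ => ENNReal.toReal_nonneg)
    (Finset.sum_le_sum fun i _ => ?_)
  have := A.log_div_sq_le_sum_expectedVisits hd hpos hle hg hδ.1 hδ' hA hN i
  rwa [hsq, one_div_div] at this

end ActiveRanking

end

/-- There are `n = m + 1` experts, and `Δ 0, …, Δ (m - 1)` are `Δ̄_1, …, Δ̄_{n-1}`. -/
theorem theorem6 {m d : ℕ} (hd : 1 ≤ d) {δ : ℝ} (hδ : δ ∈ Set.Ioo (0 : ℝ) 1)
    (Δ : Fin m → ℝ) (hΔ_pos : ∀ i, 0 < Δ i) (hΔ_mono : Monotone Δ)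
    (hΔ_le : ∀ i, Δ i ^ 2 ≤ (d : ℝ))
    {S : Type*} [MeasurableSpace S] (A : ActiveRanking.Algorithm (m + 1) d S)
    (hA : A.IsAccurate δ) :
    ∃ ν ∈ ActiveRanking.gapClass d Δ,
      ENNReal.ofReal (∑ i : Fin m, (d : ℝ) / Δ i ^ 2 * Real.log (1 / (4 * δ))) ≤
        A.expectedQueries ν :=
  ActiveRanking.exists_mem_gapClass_le_expectedQueries hd hδ Δ hΔ_pos hΔ_mono hΔ_le A hA
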